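/- A \emph{length function} on a monoid $S$ is a homomorphism $\lambda\colon S\to(\mathbb{N},+)$ such that $\lambda^{-1}(0)$ is the group of units of $S$. A monoid is \emph{equidivisible} if $ab=cd$ implies that there is $u$ with $a=cu$, $d=ub$, or $v$ with $c=av$, $b=vd$. A \emph{left Rees monoid} is a left cancellative equidivisible monoid that has a length function and at least one noninvertible element; a \emph{Rees monoid} is a left Rees monoid that is also right cancellative. The \emph{universal group} of a monoid $S$ is a group $U(S)$ with a homomorphism $\iota\colon S\to U(S)$ through which every homomorphism from $S$ to a group factors uniquely. Let $S$ be a left Rees monoid with group of units $G$. A \emph{basis} of $S$ is a transversal $X$ of the generators of the maximal proper principal right ideals of $S$. Given a basis $X$, the group $G$ acts on $X$, $g\cdot x$ being the unique $y\in X$ with $gx\in yG$. Let $(X_i)_{i\in I}$ be the orbits of this action. The \emph{irreducible components} of $S$ are the submonoids $S_i=X_i^{*}G$, where $X_i^{*}$ is the submonoid generated by $X_i$. \textbf{Theorem.} (1) A left Rees monoid can be embedded in a group if and only if it is right cancellative. (2) Let $S$ be a Rees monoid with group of units $G$, and let $(S_i)_{i\in I}$ be its irreducible components (with respect to any basis).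 Then for each $i$ the canonical homomorphism $G\to U(S_i)$ is injective, and the universal group of $S$ is the free product of the groups $U(S_i)$ with amalgamated subgroup $G$: there is an isomorphism from $U(S)$ to $\ast_{G}\,U(S_i)$ which, for each $i$, carries the image in $U(S)$ of each $s\in S_i$ to the image of $s$ under $S_i\to U(S_i)\to \ast_{G}\,U(S_i)$. Furthermore, $\iota\colon S\to U(S)$ is injective. -/

import Mathlib

universe u v

/-- Equidivisible monoids. -/
def IsEquidivisible (S : Type u) [Monoid S] : Prop :=
  ∀ a b c d : S, a * b = c * d →
    (∃ w : S, a = c * w ∧ d = w * b) ∨ (∃ w : S, c = a * w ∧ b = w * d)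

/-- A length function: a homomorphism to the additive monoid of natural numbers
such that the preimage of `0` (that is, of `1 : Multiplicative ℕ`) is the group of units. -/
def IsLengthFunction {S : Type u} [Monoid S] (ℓ : S →* Multiplicative ℕ) : Prop :=
  ∀ a : S, ℓ a = 1 ↔ IsUnit a

/-- Levi monoids: equidivisible monoids that admit a length function and contain at least one
noninvertible element. -/
structure IsLeviMonoid (S : Type u) [Monoid S] : Prop where
  equidivisible : IsEquidivisible S
  exists_length : ∃ ℓ : S →* Multiplicative ℕ, IsLengthFunction ℓ
  exists_not_isUnit : ∃ a : S, ¬ IsUnit a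

/-- Left Rees monoids: left cancellative Levi monoids. -/
structure IsLeftReesMonoid (S : Type u) [Monoid S] : Prop extends
  IsLeviMonoid S, IsLeftCancelMul S

/-- Rees monoids: cancellative Levi monoids. -/
structure IsReesMonoid (S : Type u) [Monoid S] : Prop extends
  IsLeviMonoid S, IsCancelMul S

/-- The monoid embeds in a group. -/
def EmbedsInGroup (S : Type u) [Monoid S] : Prop :=
  ∃ (H : Type u) (_ : Group H) (f : S →* H), Function.Injective f

section Basis

variable {S : Type u} [Monoid S]

/-- The principal right ideal `aS`. -/
def principalRightIdeal (a : S) : Set S := {s | ∃ t : S, s = a * t}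

/-- `I` is maximal among the proper principal right ideals. -/
def IsMaximalProperPrincipalRightIdeal (I : Set S) : Prop :=
  Maximal (fun J : Set S => (∃ a : S, J = principalRightIdeal a) ∧ J ≠ Set.univ) I

/-- A (left) basis: a transversal of the generators of the maximal proper principal right ideals,
i.e. `x ↦ xS` is a bijection from `X` to the set of maximal proper principal right ideals. -/
def IsLeftBasis (X : Set S) : Prop :=
  Set.BijOn principalRightIdeal X {I : Set S | IsMaximalProperPrincipalRightIdeal I}

/-- The relation of lying in the same orbit of the action of the group of units on a basis `X`.
In a left Rees monoid, for a unit `g` and `x ∈ X` the element `g · x` is the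
unique `y ∈ X` such that `gx = yh` for some unit `h`. -/
def basisOrbitRel (X : Set S) : Setoid X where
  r x y := ∃ g h : Sˣ, (g : S) * x = y * h
  iseqv :=
    { refl := fun _ => ⟨1, 1, by simp⟩
      symm := by
        rintro x y ⟨g, h, e⟩
        refine ⟨g⁻¹, h⁻¹, ?_⟩
        rw [Units.inv_mul_eq_iff_eq_mul, ← mul_assoc, e, mul_assoc, Units.mul_inv, mul_one]
      trans := by
        rintro x y z ⟨g, h, e⟩ ⟨g', h', e'⟩
        refine ⟨g' * g, h' * h, ?_⟩
        simp only [Units.val_mul]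
        rw [mul_assoc, e, ← mul_assoc, e', mul_assoc] }

/-- The set of orbits of the group of units on a basis `X`. -/
abbrev BasisOrbit (X : Set S) : Type u := Quotient (basisOrbitRel X)

/-- The set of elements of the basis `X` lying in the orbit `i`. -/
def orbitSet (X : Set S) (i : BasisOrbit X) : Set S :=
  {s | ∃ x : X, (x : S) = s ∧ Quotient.mk (basisOrbitRel X) x = i}

/-- The component of `S` attached to the orbit `X_i` of the group of units `G` on the basis `X`:
the submonoid generated by `X_i` and `G`. In a left Rees monoid it is `X_i^* G`, see
`mem_reesComponent_iff`. -/
def reesComponent (X : Set S) (i : BasisOrbit X) : Submonoid S :=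
  Submonoid.closure (orbitSet X i ∪ {s | IsUnit s})

theorem exists_unit_mul_orbitSet (hS : IsLeftReesMonoid S) {X : Set S} (hX : IsLeftBasis X)
    {i : BasisOrbit X} (g : Sˣ) {x : S} (hx : x ∈ orbitSet X i) :
    ∃ y ∈ orbitSet X i, ∃ h : Sˣ, (g : S) * x = y * h := by
  have := hS.toIsLeftCancelMul
  obtain ⟨x, rfl, rfl⟩ := hx
  have hm : IsMaximalProperPrincipalRightIdeal (principalRightIdeal ((g : S) * x)) := by
    have hxm : IsMaximalProperPrincipalRightIdeal (principalRightIdeal (x : S)) :=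
      hX.mapsTo x.2
    refine ⟨⟨⟨_, rfl⟩, fun hu => ?_⟩, ?_⟩
    · apply hxm.prop.2
      rw [Set.eq_univ_iff_forall] at hu ⊢
      intro s
      obtain ⟨t, ht⟩ := hu (g * s)
      exact ⟨t, by rwa [mul_assoc, Units.mul_right_inj] at ht⟩
    · rintro _ ⟨⟨b, rfl⟩, hb⟩ hle
      have hprop : principalRightIdeal (((g⁻¹ : Sˣ) : S) * b) ≠ Set.univ := by
        intro hu
        apply hb
        rw [Set.eq_univ_iff_forall] at hu ⊢
        intro s
        obtain ⟨t, ht⟩ := hu ((g⁻¹ : Sˣ) * s)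
        exact ⟨t, by rwa [mul_assoc, Units.mul_right_inj] at ht⟩
      have hle' : principalRightIdeal (x : S) ≤ principalRightIdeal (((g⁻¹ : Sˣ) : S) * b) := by
        rintro _ ⟨t, rfl⟩
        obtain ⟨r, hr⟩ := hle ⟨t, rfl⟩
        refine ⟨r, ?_⟩
        rw [mul_assoc, ← hr, mul_assoc, Units.inv_mul_cancel_left]
      have hge := hxm.2 ⟨⟨_, rfl⟩, hprop⟩ hle'
      rintro _ ⟨t, rfl⟩
      obtain ⟨r, hr⟩ := hge ⟨t, rfl⟩
      refine ⟨r, ?_⟩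
      rw [mul_assoc, ← hr, mul_assoc, Units.mul_inv_cancel_left]
  obtain ⟨y, hyX, hy⟩ := hX.surjOn hm
  obtain ⟨s, hs⟩ : y ∈ principalRightIdeal ((g : S) * x) := hy ▸ ⟨1, (mul_one y).symm⟩
  obtain ⟨t, ht⟩ : (g : S) * x ∈ principalRightIdeal y := hy ▸ ⟨1, (mul_one _).symm⟩
  have hst : s * t = 1 := by
    apply mul_left_cancel (a := (g : S) * x)
    rw [← mul_assoc, ← hs, ← ht, mul_one]
  have hts : t * s = 1 := by
    apply mul_left_cancel (a := y)
    rw [← mul_assoc, ← ht, ← hs, mul_one]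
  refine ⟨y, ⟨⟨y, hyX⟩, rfl, ?_⟩, ⟨t, s, hts, hst⟩, ht⟩
  exact Quotient.sound ((basisOrbitRel X).symm ⟨g, ⟨t, s, hts, hst⟩, ht⟩)

/-- In a left Rees monoid with group of units `G` and basis `X`, the component attached to the
orbit `X_i` is `X_i^* G`. -/
theorem mem_reesComponent_iff (hS : IsLeftReesMonoid S) {X : Set S} (hX : IsLeftBasis X)
    (i : BasisOrbit X) (s : S) :
    s ∈ reesComponent X i ↔
      ∃ w ∈ Submonoid.closure (orbitSet X i), ∃ g : Sˣ, s = w * g := by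
  constructor
  · have key : ∀ w ∈ Submonoid.closure (orbitSet X i), ∀ g : Sˣ,
        ∃ w' ∈ Submonoid.closure (orbitSet X i), ∃ h : Sˣ, (g : S) * w = w' * h := by
      intro w hw
      induction hw using Submonoid.closure_induction_left with
      | one => exact fun g => ⟨1, one_mem _, g, by simp⟩
      | mul_left x hx w _ ih =>
        intro g
        obtain ⟨y, hy, h, e⟩ := exists_unit_mul_orbitSet hS hX g hx
        obtain ⟨w', hw', k, e'⟩ := ih h
        refine ⟨y * w', mul_mem (Submonoid.subset_closure hy) hw', k, ?_⟩
        rw [← mul_assoc, e, mul_assoc, e', mul_assoc]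
    intro hs
    induction hs using Submonoid.closure_induction_left with
    | one => exact ⟨1, one_mem _, 1, by simp⟩
    | mul_left x hx s _ ih =>
      obtain ⟨w, hw, g, rfl⟩ := ih
      rcases hx with hx | ⟨k, rfl⟩
      · exact ⟨x * w, mul_mem (Submonoid.subset_closure hx) hw, g, (mul_assoc _ _ _).symm⟩
      · obtain ⟨w', hw', h, e⟩ := key w hw k
        exact ⟨w', hw', h * g, by rw [← mul_assoc, e, mul_assoc, Units.val_mul]⟩
  · rintro ⟨w, hw, g, rfl⟩
    exact mul_mem (Submonoid.closure_mono Set.subset_union_left hw)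
      (Submonoid.subset_closure (Or.inr g.isUnit))

/-- The inclusion of the group of units of `S` into a component. -/
def unitsToComponent (X : Set S) (i : BasisOrbit X) : Sˣ →* reesComponent X i :=
  (Units.coeHom S).codRestrict (reesComponent X i)
    (fun g => Submonoid.subset_closure (Or.inr g.isUnit))

end Basis

/-- The universal group `U(S)` of a monoid `S`: the group generated by the elements of `S`
subject to the relations given by the multiplication table of `S`. -/
abbrev UniversalGroup (S : Type u) [Monoid S] : Type u :=
  PresentedGroup {r : FreeGroup S |
    ∃ a b : S, r = FreeGroup.of a * FreeGroup.of b * (FreeGroup.of (a * b))⁻¹}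

namespace UniversalGroup

variable {S : Type u} [Monoid S]

theorem of_mul (a b : S) :
    (PresentedGroup.of (a * b) : UniversalGroup S) =
      PresentedGroup.of a * PresentedGroup.of b := by
  have h : (PresentedGroup.mk _ (FreeGroup.of a * FreeGroup.of b * (FreeGroup.of (a * b))⁻¹) :
      UniversalGroup S) = 1 := PresentedGroup.one_of_mem ⟨a, b, rfl⟩
  rw [map_mul, map_inv, mul_inv_eq_one, map_mul] at h
  exact h.symm

/-- The canonical homomorphism `ι : S → U(S)`. -/
def ι (S : Type u) [Monoid S] : S →* UniversalGroup S :=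
  MonoidHom.mk' (fun s => PresentedGroup.of s) of_mul

/-- The universal property: every homomorphism from `S` to a group factors uniquely through `ι`. -/
theorem existsUnique_lift {H : Type v} [Group H] (φ : S →* H) :
    ∃! ψ : UniversalGroup S →* H, ψ.comp (ι S) = φ := by
  have hrel : ∀ r ∈ {r : FreeGroup S |
      ∃ a b : S, r = FreeGroup.of a * FreeGroup.of b * (FreeGroup.of (a * b))⁻¹},
      FreeGroup.lift φ r = 1 := by
    rintro _ ⟨a, b, rfl⟩
    simp
  refine ⟨PresentedGroup.toGroup hrel, ?_, ?_⟩
  · ext s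
    exact PresentedGroup.toGroup.of hrel
  · intro ψ hψ
    ext s
    rw [PresentedGroup.toGroup.of hrel]
    exact DFunLike.congr_fun hψ s

end UniversalGroup

/-- The homomorphism from the group of units `G` of `S` to the universal group of a component. -/
def unitsToUniversalGroup {S : Type u} [Monoid S] (X : Set S) (i : BasisOrbit X) :
    Sˣ →* UniversalGroup (reesComponent X i) :=
  (UniversalGroup.ι (reesComponent X i)).comp (unitsToComponent X i)

/-!
A left Rees monoid `S` with group of units `G` and basis `X` has unique normal forms `x₁ ⋯ xₙ g`
with `xᵢ ∈ X` and `g ∈ G`: existence follows from the length function, uniqueness from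
equidivisibility and left cancellation (`IsLeftBasis.wordProd_surjective`,
`IsLeftBasis.wordProd_injective`). Hence `S` is presented by `G` and `X` subject to the relations
`gx = yh` (`IsLeftBasis.exists_hom`). In such a relation `x` and `y` lie in the same orbit of `G`,
so the relation holds in a single component; comparing universal properties identifies `U(S)` with
the free product of the `U(Sᵢ)` with `G` amalgamated (`IsLeftBasis.exists_universalGroup_equiv`).

All the injectivity assertions follow from one embedding of a cancellative `S` in a group of
permutations, for which no normal forms in HNN extensions or amalgamated products are needed. Let
`Ω = S × L` with `L` a large set; `G` acts on `Ω` by left multiplication on the first factor, freely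
by right cancellation. For an orbit representative `x`, the pairs `(g, h)` with `gx = xh` form a
group `Γ`, which acts on `Ω` freely in two ways, through `h` and through `g`. The injection
`s ↦ xs` of `S` into itself carries the first action to the second. If `L` is large enough, then
as many free orbits are left over on either side, so the injection extends to a permutation of `Ω`
that carries the first action to the second (`exists_equivariant_perm_extending`,
`exists_perm_extending_mul_left`). These permutations, transported along the orbits, satisfy the
defining relations of `S`, and the resulting action of `S` on `Ω` extends left multiplication on
`S`, so that it is faithful (`IsReesMonoid.exists_hom_perm`).
-/

/-! ### Extending equivariant partial injections between free group actions -/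

/-- A choice of orbit representatives identifies a free `Γ`-set `C` with the product of `Γ` and the
set of orbits. -/
theorem bijective_smul_out {Γ C : Type*} [Group Γ] [MulAction Γ C]
    (hC : ∀ (γ : Γ) (c : C), γ • c = c → γ = 1) :
    Function.Bijective
      (fun p : Γ × MulAction.orbitRel.Quotient Γ C => p.1 • (Quotient.out p.2 : C)) := by
  constructor
  · rintro ⟨γ, q⟩ ⟨δ, r⟩ h
    simp only at h
    have hqr : q = r := by
      rw [← Quotient.out_eq q, ← Quotient.out_eq r]
      exact Quotient.sound ⟨γ⁻¹ * δ, by simp [mul_smul, ← h]⟩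
    subst hqr
    have := hC (δ⁻¹ * γ) _ (by rw [mul_smul, h, inv_smul_smul])
    rw [inv_mul_eq_one] at this
    rw [this]
  · intro c
    obtain ⟨γ, hγ⟩ := Quotient.exact (Quotient.out_eq (Quotient.mk (MulAction.orbitRel Γ C) c))
    exact ⟨(γ⁻¹, Quotient.mk _ c), by simp [← hγ]⟩

theorem nonempty_orbits_equiv {Γ C L : Type*} [Group Γ] [MulAction Γ C] {j : C → L}
    (hj : Function.Injective j) {i : L → C} (hi : ∀ (γ : Γ) (l m : L), γ • i l = i m → l = m) :
    Nonempty (MulAction.orbitRel.Quotient Γ C ≃ L) := by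
  refine Function.Embedding.antisymm ⟨fun q => j q.out, ?_⟩ ⟨fun l => Quotient.mk _ (i l), ?_⟩
  · intro q r h
    rw [← Quotient.out_eq q, ← Quotient.out_eq r, hj h]
  · intro l m h
    obtain ⟨γ, hγ⟩ := Quotient.exact h
    exact (hi γ m l hγ).symm

/-- Two free actions of a group are isomorphic if both sets embed in a type `L`, and `L` embeds
in both sets of orbits: by Schröder–Bernstein, both sets of orbits are equinumerous with `L`. -/
theorem exists_equivariant_equiv {Γ A B L : Type*} [Group Γ] [MulAction Γ A] [MulAction Γ B]
    (hA : ∀ (γ : Γ) (a : A), γ • a = a → γ = 1) (hB : ∀ (γ : Γ) (b : B), γ • b = b → γ = 1)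
    {jA : A → L} (hjA : Function.Injective jA) {jB : B → L} (hjB : Function.Injective jB)
    {iA : L → A} (hiA : ∀ (γ : Γ) (l m : L), γ • iA l = iA m → l = m)
    {iB : L → B} (hiB : ∀ (γ : Γ) (l m : L), γ • iB l = iB m → l = m) :
    ∃ t : A ≃ B, ∀ (γ : Γ) (a : A), t (γ • a) = γ • t a := by
  obtain ⟨eA⟩ := nonempty_orbits_equiv hjA hiA
  obtain ⟨eB⟩ := nonempty_orbits_equiv hjB hiB
  let bA := Equiv.ofBijective _ (bijective_smul_out hA)
  let bB := Equiv.ofBijective _ (bijective_smul_out hB)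
  refine ⟨bA.symm.trans (((Equiv.refl Γ).prodCongr (eA.trans eB.symm)).trans bB), fun γ a => ?_⟩
  obtain ⟨⟨δ, q⟩, rfl⟩ := bA.surjective a
  have : γ • bA (δ, q) = bA (γ * δ, q) := (mul_smul _ _ _).symm
  rw [this]
  simp [bB, mul_smul]

/-- Let a group `Γ` act freely on `Ω` in two ways, `α` and `β`, and let `j` be an injection of an
`α`-invariant subset `P` into `Ω` that carries `α` to `β`. If there are as many orbits outside `P`
and outside `j(P)` as there are elements of `Ω`, then `j` extends to a permutation of `Ω` that
carries `α` to `β`. -/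
theorem exists_equivariant_perm_extending {Γ Ω L : Type*} [Group Γ] (α β : Γ →* Equiv.Perm Ω)
    (hα : ∀ γ ω, α γ ω = ω → γ = 1) (hβ : ∀ γ ω, β γ ω = ω → γ = 1)
    {P : Set Ω} (hP : ∀ γ, ∀ ω ∈ P, α γ ω ∈ P) {j : Ω → Ω} (hj : Set.InjOn j P)
    (hjP : ∀ γ, ∀ ω ∈ P, j (α γ ω) = β γ (j ω))
    {k : Ω → L} (hk : Function.Injective k) {i : L → Ω} (hiP : ∀ l, i l ∉ P)
    (hij : ∀ l, i l ∉ j '' P) (hiα : ∀ γ l m, α γ (i l) = i m → l = m)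
    (hiβ : ∀ γ l m, β γ (i l) = i m → l = m) :
    ∃ t : Equiv.Perm Ω, (∀ γ ω, t (α γ ω) = β γ (t ω)) ∧ ∀ ω ∈ P, t ω = j ω := by
  classical
  have hP' : ∀ γ, ∀ ω ∈ Pᶜ, α γ ω ∈ Pᶜ := fun γ ω h h' => h (by simpa using hP γ⁻¹ _ h')
  have hQ' : ∀ γ, ∀ ω ∈ (j '' P)ᶜ, β γ ω ∈ (j '' P)ᶜ := by
    rintro γ ω h ⟨p, hp, hpω⟩
    refine h ⟨α γ⁻¹ p, hP _ _ hp, ?_⟩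
    rw [hjP _ _ hp, hpω]
    simp
  let : MulAction Γ ↑Pᶜ :=
    { smul γ ω := ⟨α γ ω, hP' γ ω ω.2⟩
      one_smul ω := Subtype.ext (show α 1 ω = ω by simp)
      mul_smul γ δ ω := Subtype.ext (show α (γ * δ) ω = α γ (α δ ω) by simp) }
  let : MulAction Γ ↑(j '' P)ᶜ :=
    { smul γ ω := ⟨β γ ω, hQ' γ ω ω.2⟩
      one_smul ω := Subtype.ext (show β 1 ω = ω by simp)
      mul_smul γ δ ω := Subtype.ext (show β (γ * δ) ω = β γ (β δ ω) by simp) }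
  obtain ⟨e, he⟩ := exists_equivariant_equiv (Γ := Γ) (A := ↑Pᶜ) (B := ↑(j '' P)ᶜ) (L := L)
    (fun γ a h => hα γ a (congrArg Subtype.val h)) (fun γ a h => hβ γ a (congrArg Subtype.val h))
    (jA := fun a => k a) (hk.comp Subtype.val_injective)
    (jB := fun a => k a) (hk.comp Subtype.val_injective)
    (iA := fun l => ⟨i l, hiP l⟩) (fun γ l m h => hiα γ l m (congrArg Subtype.val h))
    (iB := fun l => ⟨i l, hij l⟩) (fun γ l m h => hiβ γ l m (congrArg Subtype.val h))
  let T : Ω → Ω := fun ω => if h : ω ∈ P then j ω else e ⟨ω, h⟩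
  have hTP : ∀ ω ∈ P, T ω = j ω := fun ω h => dif_pos h
  have hTP' : ∀ (ω) (h : ω ∉ P), T ω = e ⟨ω, h⟩ := fun ω h => dif_neg h
  have hT : Function.Bijective T := by
    constructor
    · intro ω ω' h
      by_cases h₁ : ω ∈ P <;> by_cases h₂ : ω' ∈ P
      · rw [hTP _ h₁, hTP _ h₂] at h
        exact hj h₁ h₂ h
      · rw [hTP _ h₁, hTP' _ h₂] at h
        exact absurd ⟨ω, h₁, h⟩ (e ⟨ω', h₂⟩).2
      · rw [hTP' _ h₁, hTP _ h₂] at h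
        exact absurd ⟨ω', h₂, h.symm⟩ (e ⟨ω, h₁⟩).2
      · rw [hTP' _ h₁, hTP' _ h₂] at h
        exact congrArg Subtype.val (e.injective (Subtype.ext h))
    · intro ω
      by_cases h : ω ∈ j '' P
      · obtain ⟨p, hp, rfl⟩ := h
        exact ⟨p, hTP p hp⟩
      · refine ⟨e.symm ⟨ω, h⟩, ?_⟩
        rw [hTP' _ (e.symm ⟨ω, h⟩).2]
        simp
  refine ⟨Equiv.ofBijective T hT, fun γ ω => ?_, hTP⟩
  change T (α γ ω) = β γ (T ω)
  by_cases h : ω ∈ P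
  · rw [hTP _ h, hTP _ (hP γ ω h), hjP γ ω h]
  · rw [hTP' _ h, hTP' _ (hP' γ ω h)]
    exact congrArg Subtype.val (he γ ⟨ω, h⟩)

/-! ### Normal forms in a left Rees monoid -/

section NormalForm

variable {S : Type u} [Monoid S]

/-- Lengths are nonnegative, so both factors of a unit have length zero. -/
theorem IsLeviMonoid.isUnit_of_isUnit_mul (hS : IsLeviMonoid S) {a b : S} (h : IsUnit (a * b)) :
    IsUnit a := by
  obtain ⟨ℓ, hℓ⟩ := hS.exists_length
  have h1 := (hℓ (a * b)).2 h
  rw [map_mul] at h1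
  exact (hℓ a).1 (Nat.add_eq_zero_iff.1 (congrArg Multiplicative.toAdd h1)).1

theorem IsLeviMonoid.principalRightIdeal_eq_univ_iff (hS : IsLeviMonoid S) {a : S} :
    principalRightIdeal a = Set.univ ↔ IsUnit a := by
  constructor
  · intro h
    obtain ⟨t, ht⟩ : (1 : S) ∈ principalRightIdeal a := h ▸ Set.mem_univ _
    exact hS.isUnit_of_isUnit_mul (ht ▸ isUnit_one)
  · rintro ⟨g, rfl⟩
    exact Set.eq_univ_of_forall fun s => ⟨(g⁻¹ : Sˣ) * s, by simp⟩

theorem principalRightIdeal_mul_le (a b : S) :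
    principalRightIdeal (a * b) ≤ principalRightIdeal a := by
  rintro _ ⟨t, rfl⟩
  exact ⟨b * t, mul_assoc _ _ _⟩

theorem mem_principalRightIdeal_self (a : S) : a ∈ principalRightIdeal a := ⟨1, (mul_one a).symm⟩

/-- In a Levi monoid every noninvertible element lies in a maximal proper principal right ideal,
namely the one generated by a noninvertible left divisor of least length. -/
theorem IsLeviMonoid.exists_mem_maximal (hS : IsLeviMonoid S) {s : S} (hs : ¬ IsUnit s) :
    ∃ I, IsMaximalProperPrincipalRightIdeal I ∧ s ∈ I := by
  obtain ⟨ℓ, hℓ⟩ := hS.exists_length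
  obtain ⟨a, ⟨ha, t, rfl⟩, hmin⟩ := WellFounded.has_min
    (measure fun a : S => Multiplicative.toAdd (ℓ a)).wf
    {a : S | ¬ IsUnit a ∧ s ∈ principalRightIdeal a} ⟨s, hs, mem_principalRightIdeal_self s⟩
  refine ⟨principalRightIdeal a, ⟨⟨⟨a, rfl⟩, fun h =>
    ha (hS.principalRightIdeal_eq_univ_iff.1 h)⟩, ?_⟩, t, rfl⟩
  rintro _ ⟨⟨b, rfl⟩, hb⟩ hle
  rw [ne_eq, hS.principalRightIdeal_eq_univ_iff] at hb
  obtain ⟨c, rfl⟩ := hle (mem_principalRightIdeal_self a)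
  have hbc := hmin b ⟨hb, c * t, mul_assoc _ _ _⟩
  have hc : IsUnit c := by
    rw [← hℓ]
    have : ¬ (ℓ b).toAdd < (ℓ (b * c)).toAdd := hbc
    rw [map_mul, toAdd_mul] at this
    exact Multiplicative.toAdd.injective (show (ℓ c).toAdd = 0 by omega)
  obtain ⟨g, rfl⟩ := hc
  rintro _ ⟨r, rfl⟩
  exact ⟨(g⁻¹ : Sˣ) * r, by simp [mul_assoc]⟩

theorem exists_isLeftBasis (S : Type u) [Monoid S] : ∃ X : Set S, IsLeftBasis X := by
  have h : Set.SurjOn principalRightIdeal Set.univ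
      {I : Set S | IsMaximalProperPrincipalRightIdeal I} := by
    rintro I ⟨⟨⟨a, rfl⟩, -⟩, -⟩
    exact ⟨a, trivial, rfl⟩
  obtain ⟨X, -, hX⟩ := h.exists_bijOn_subset
  exact ⟨X, hX⟩

variable {X : Set S}

theorem IsLeftBasis.isMaximal (hX : IsLeftBasis X) {x : S} (hx : x ∈ X) :
    IsMaximalProperPrincipalRightIdeal (principalRightIdeal x) := hX.mapsTo hx

theorem IsLeftBasis.not_isUnit (hX : IsLeftBasis X) (hS : IsLeviMonoid S) {x : S} (hx : x ∈ X) :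
    ¬ IsUnit x := fun h => (hX.isMaximal hx).prop.2 (hS.principalRightIdeal_eq_univ_iff.2 h)

theorem IsLeftBasis.exists_eq_mul (hX : IsLeftBasis X) (hS : IsLeviMonoid S) {s : S}
    (hs : ¬ IsUnit s) : ∃ x : X, ∃ t, s = x * t := by
  obtain ⟨I, hI, hsI⟩ := hS.exists_mem_maximal hs
  obtain ⟨x, hx, rfl⟩ := hX.surjOn hI
  exact ⟨⟨x, hx⟩, hsI⟩

/-- The element `x₁ ⋯ xₙ g` of a monoid attached to a word in a subset and a unit. -/
def wordProd (X : Set S) (p : List X × Sˣ) : S := (p.1.map Subtype.val).prod * p.2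

@[simp] theorem wordProd_nil (g : Sˣ) : wordProd X ([], g) = g := by simp [wordProd]

@[simp] theorem wordProd_cons (x : X) (l : List X) (g : Sˣ) :
    wordProd X (x :: l, g) = x * wordProd X (l, g) := by simp [wordProd, mul_assoc]

theorem IsLeftBasis.wordProd_surjective (hX : IsLeftBasis X) (hS : IsLeviMonoid S) :
    Function.Surjective (wordProd X) := by
  obtain ⟨ℓ, hℓ⟩ := hS.exists_length
  intro s
  induction hn : (ℓ s).toAdd using Nat.strong_induction_on generalizing s with
  | _ n ih =>
    by_cases hs : IsUnit s
    · exact ⟨([], hs.unit), by simp⟩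
    · obtain ⟨x, t, rfl⟩ := hX.exists_eq_mul hS hs
      have hx : (ℓ x).toAdd ≠ 0 := fun h =>
        hX.not_isUnit hS x.2 ((hℓ x).1 (Multiplicative.toAdd.injective h))
      rw [map_mul, toAdd_mul] at hn
      obtain ⟨⟨l, g⟩, rfl⟩ := ih (ℓ t).toAdd (by omega) t rfl
      exact ⟨(x :: l, g), by simp⟩

/-- By equidivisibility, principal right ideals that meet are comparable, so that the first
letter of a word is determined by its product. -/
theorem IsLeftBasis.eq_of_mul_eq_mul (hX : IsLeftBasis X) (hS : IsLeviMonoid S) {x y : X} {s t : S}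
    (h : (x : S) * s = y * t) : x = y := by
  have key : ∀ (x y : X) (w : S), (x : S) = y * w → x = y := by
    intro x y w hw
    have hle : principalRightIdeal (x : S) ≤ principalRightIdeal (y : S) :=
      hw ▸ principalRightIdeal_mul_le _ _
    exact Subtype.ext (hX.injOn x.2 y.2
      (le_antisymm hle ((hX.isMaximal x.2).2 (hX.isMaximal y.2).prop hle)))
  rcases hS.equidivisible _ _ _ _ h with ⟨w, hw, -⟩ | ⟨w, hw, -⟩
  · exact key x y w hw
  · exact (key y x w hw).symm

theorem IsLeftBasis.wordProd_injective (hX : IsLeftBasis X) (hS : IsLeftReesMonoid S) :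
    Function.Injective (wordProd X) := by
  have := hS.toIsLeftCancelMul
  have hunit : ∀ (x : X) (s : S) (g : Sˣ), (x : S) * s ≠ g := fun x s g h =>
    hX.not_isUnit hS.toIsLeviMonoid x.2
      (hS.toIsLeviMonoid.isUnit_of_isUnit_mul (h ▸ g.isUnit))
  rintro ⟨l, g⟩ ⟨m, h⟩ e
  induction l generalizing m with
  | nil =>
    cases m with
    | nil => simpa [Units.ext_iff] using e
    | cons y m =>
      rw [wordProd_nil, wordProd_cons] at e
      exact absurd e.symm (hunit _ _ _)
  | cons x l ih =>
    cases m with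
    | nil =>
      rw [wordProd_nil, wordProd_cons] at e
      exact absurd e (hunit _ _ _)
    | cons y m =>
      rw [wordProd_cons, wordProd_cons] at e
      obtain rfl := hX.eq_of_mul_eq_mul hS.toIsLeviMonoid e
      have := ih m (mul_left_cancel e)
      simp only [Prod.mk.injEq] at this ⊢
      exact ⟨by rw [this.1], this.2⟩

/-- The action of a unit on the basis, written as a relation in `S`. -/
theorem IsLeftBasis.exists_unit_mul (hX : IsLeftBasis X) (hS : IsLeftReesMonoid S) (g : Sˣ)
    (x : X) : ∃ (y : X) (h : Sˣ), (g : S) * x = y * h := by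
  obtain ⟨_, ⟨y, rfl, -⟩, h, e⟩ := exists_unit_mul_orbitSet hS hX
    (i := Quotient.mk (basisOrbitRel X) x) g ⟨x, rfl, rfl⟩
  exact ⟨y, h, e⟩

/-- A left Rees monoid is presented by its units and a basis, subject to the multiplication of
units and the relations `gx = yh`. -/
theorem IsLeftBasis.exists_hom (hX : IsLeftBasis X) (hS : IsLeftReesMonoid S) {K : Type*}
    [Monoid K] (f : X → K) (c : Sˣ →* K)
    (hfc : ∀ (g h : Sˣ) (x y : X), (g : S) * x = y * h → c g * f x = f y * c h) :
    ∃ F : S →* K, (∀ x : X, F x = f x) ∧ ∀ g : Sˣ, F g = c g := by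
  obtain ⟨F, hF⟩ : ∃ F : S → K, ∀ p, F (wordProd X p) = (p.1.map f).prod * c p.2 :=
    ⟨_, (hX.wordProd_injective hS).extend_apply (fun p => (p.1.map f).prod * c p.2) 1⟩
  have hsurj := hX.wordProd_surjective hS.toIsLeviMonoid
  have hFg : ∀ g : Sˣ, F g = c g := fun g => by simpa using hF ([], g)
  have hFx : ∀ (x : X) (s : S), F (x * s) = f x * F s := by
    intro x s
    obtain ⟨⟨l, g⟩, rfl⟩ := hsurj s
    rw [← wordProd_cons, hF, hF]
    simp [mul_assoc]
  have hFgm : ∀ (g : Sˣ) (s : S), F (g * s) = c g * F s := by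
    intro g s
    obtain ⟨⟨l, k⟩, rfl⟩ := hsurj s
    induction l generalizing g with
    | nil => rw [wordProd_nil, ← Units.val_mul, hFg, hFg, map_mul]
    | cons x l ih =>
      obtain ⟨y, h, hy⟩ := hX.exists_unit_mul hS g x
      rw [wordProd_cons, ← mul_assoc, hy, mul_assoc, hFx, hFx, ih, ← mul_assoc, ← mul_assoc,
        hfc g h x y hy]
  have hmul : ∀ s t, F (s * t) = F s * F t := by
    intro s t
    obtain ⟨⟨l, k⟩, rfl⟩ := hsurj s
    induction l with
    | nil => rw [wordProd_nil, hFgm, hFg]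
    | cons x l ih => rw [wordProd_cons, mul_assoc, hFx, hFx, ih, mul_assoc]
  have h1 : F 1 = 1 := by simpa using hFg 1
  refine ⟨⟨⟨F, h1⟩, hmul⟩, fun x => ?_, hFg⟩
  have := hFx x 1
  rw [mul_one, h1, mul_one] at this
  exact this

theorem IsLeftBasis.hom_ext (hX : IsLeftBasis X) (hS : IsLeviMonoid S) {K : Type*} [Monoid K]
    {F F' : S →* K} (hx : ∀ x : X, F x = F' x) (hg : ∀ g : Sˣ, F g = F' g) : F = F' := by
  ext s
  obtain ⟨⟨l, g⟩, rfl⟩ := hX.wordProd_surjective hS s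
  induction l with
  | nil => simp [hg]
  | cons x l ih => rw [wordProd_cons, map_mul, map_mul, ih, hx]

end NormalForm

/-! ### A faithful action of a Rees monoid by permutations -/

section Embedding

variable {S : Type u} [Monoid S]

/-- The group of units of `S` acts on `S × L` by left multiplication on the first factor. -/
def unitsPerm (S : Type u) [Monoid S] (L : Type v) : Sˣ →* Equiv.Perm (S × L) where
  toFun g := (Units.mulLeft g).prodCongr (Equiv.refl L)
  map_one' := by ext p <;> simp
  map_mul' g h := by ext p <;> simp [mul_assoc]

@[simp] theorem unitsPerm_apply {L : Type v} (g : Sˣ) (s : S) (l : L) :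
    unitsPerm S L g (s, l) = (g * s, l) := rfl

/-- The pairs of units `(g, h)` such that `gx = xh`. -/
def intertwiningUnits (x : S) : Subgroup (Sˣ × Sˣ) where
  carrier := {p | (p.1 : S) * x = x * p.2}
  mul_mem' {p q} hp hq := by
    simp only [Set.mem_ofPred_eq, Prod.fst_mul, Prod.snd_mul, Units.val_mul] at *
    rw [mul_assoc, hq, ← mul_assoc, hp, mul_assoc]
  one_mem' := by simp
  inv_mem' {p} hp := by
    simp only [Set.mem_ofPred_eq, Prod.fst_inv, Prod.snd_inv] at *
    rw [Units.inv_mul_eq_iff_eq_mul, ← mul_assoc, hp, mul_assoc, Units.mul_inv, mul_one]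

/-- In a cancellative monoid, left multiplication by `x` extends from `S`, embedded in
`S × List S` as `S × {[]}`, to a permutation that satisfies the relations `gx = xh`. The factor
`List S` only serves to provide enough orbits. -/
theorem exists_perm_extending_mul_left [IsCancelMul S] (x : S) :
    ∃ t : Equiv.Perm (S × List S),
      (∀ g h : Sˣ, (g : S) * x = x * h →
        unitsPerm S (List S) g * t = t * unitsPerm S (List S) h) ∧
      ∀ s : S, t (s, []) = (x * s, []) := by
  let α : intertwiningUnits x →* Equiv.Perm (S × List S) :=
    (unitsPerm S (List S)).comp ((MonoidHom.snd _ _).comp (intertwiningUnits x).subtype)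
  let β : intertwiningUnits x →* Equiv.Perm (S × List S) :=
    (unitsPerm S (List S)).comp ((MonoidHom.fst _ _).comp (intertwiningUnits x).subtype)
  have hα : ∀ γ s l, α γ (s, l) = (γ.1.2 * s, l) := fun _ _ _ => rfl
  have hβ : ∀ γ s l, β γ (s, l) = (γ.1.1 * s, l) := fun _ _ _ => rfl
  -- Each of the two components of an intertwining pair determines the other by cancellation.
  have hγ : ∀ γ : intertwiningUnits x, γ.1.1 = 1 ↔ γ.1.2 = 1 := by
    rintro ⟨⟨g, h⟩, hgh⟩
    change (g : S) * x = x * h at hgh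
    change g = 1 ↔ h = 1
    constructor
    · rintro rfl
      simpa [eq_comm] using hgh
    · rintro rfl
      simpa using hgh
  obtain ⟨t, ht, htP⟩ := exists_equivariant_perm_extending (L := List S) α β
    (by
      rintro γ ⟨s, l⟩ h
      have h2 : γ.1.2 = 1 := by simpa [hα] using h
      exact Subtype.ext (Prod.ext ((hγ γ).2 h2) h2))
    (by
      rintro γ ⟨s, l⟩ h
      have h1 : γ.1.1 = 1 := by simpa [hβ] using h
      exact Subtype.ext (Prod.ext h1 ((hγ γ).1 h1)))
    (P := {p | p.2 = []}) (fun γ ω h => h) (j := fun p => (x * p.1, p.2))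
    (by
      rintro ⟨s, l⟩ - ⟨s', l'⟩ - h
      simpa using h)
    (by
      rintro γ ⟨s, l⟩ -
      simp only [hα, hβ, ← mul_assoc]
      rw [show (γ.1.1 : S) * x = x * γ.1.2 from γ.2])
    (k := fun p => p.1 :: p.2)
    (by
      rintro ⟨s, l⟩ ⟨s', l'⟩ h
      simpa using h)
    (i := fun l => (1, 1 :: l)) (by simp) (by simp)
    (by
      intro γ l m h
      rw [hα] at h
      simpa using congrArg Prod.snd h)
    (by
      intro γ l m h
      rw [hβ] at h
      simpa using congrArg Prod.snd h)
  exact ⟨t, fun g h hgh => Equiv.ext fun ω => (ht ⟨(g, h), hgh⟩ ω).symm, fun s => htP _ rfl⟩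

/-- Every Rees monoid acts on `S × List S` by permutations in such a way that the action on
`S × {[]}` is by left multiplication. -/
theorem IsReesMonoid.exists_hom_perm (hS : IsReesMonoid S) :
    ∃ F : S →* Equiv.Perm (S × List S), ∀ s r, F s (r, []) = (s * r, []) := by
  have := hS.toIsCancelMul
  have hS' : IsLeftReesMonoid S := ⟨hS.toIsLeviMonoid, inferInstance⟩
  obtain ⟨X, hX⟩ := exists_isLeftBasis S
  choose t ht htS using fun x : S => exists_perm_extending_mul_left x
  -- Each `y ∈ X` is written as `a y * x * (b y)⁻¹` with `x = rep y` the representative of its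
  -- orbit, and acts accordingly.
  let rep : X → X := fun y => (Quotient.mk (basisOrbitRel X) y).out
  have hrep : ∀ y, ∃ a b : Sˣ, (a : S) * rep y = y * b := fun y =>
    Quotient.exact (Quotient.out_eq (Quotient.mk (basisOrbitRel X) y))
  choose a b hab using hrep
  let c := unitsPerm S (List S)
  obtain ⟨F, hFX, hFG⟩ := hX.exists_hom hS' (fun y => c (a y) * t (rep y) * (c (b y))⁻¹) c (by
    intro g h y z hyz
    have hr : rep y = rep z :=
      congrArg Quotient.out (Quotient.sound (s := basisOrbitRel X) ⟨g, h, hyz⟩)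
    have hy := hab y
    have hz := hab z
    rw [hr] at hy
    rw [hr]
    have key := ht (rep z) ((a z)⁻¹ * g * a y) ((b z)⁻¹ * h * b y) (by
      simp only [Units.val_mul]
      rw [mul_assoc, hy, mul_assoc, Units.inv_mul_eq_iff_eq_mul, ← mul_assoc (g : S), hyz,
        ← mul_assoc, ← mul_assoc, ← mul_assoc, hz]
      simp [mul_assoc])
    have key' : (c (a z))⁻¹ * c g * c (a y) * t (rep z) =
        t (rep z) * ((c (b z))⁻¹ * c h * c (b y)) := by
      simpa only [map_mul, map_inv] using key
    calc c g * (c (a y) * t (rep z) * (c (b y))⁻¹)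
        = c (a z) * ((c (a z))⁻¹ * c g * c (a y) * t (rep z)) * (c (b y))⁻¹ := by group
      _ = c (a z) * (t (rep z) * ((c (b z))⁻¹ * c h * c (b y))) * (c (b y))⁻¹ := by rw [key']
      _ = c (a z) * t (rep z) * (c (b z))⁻¹ * c h := by group)
  refine ⟨F, fun s => ?_⟩
  obtain ⟨⟨l, g⟩, rfl⟩ := hX.wordProd_surjective hS.toIsLeviMonoid s
  induction l with
  | nil => intro r; rw [wordProd_nil, hFG]; rfl
  | cons y l ih =>
    intro r
    rw [wordProd_cons, map_mul, Equiv.Perm.mul_apply, ih, hFX, mul_assoc]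
    have hinv : ∀ s, (c (b y))⁻¹ (s, []) = (((b y)⁻¹ : Sˣ) * s, []) := fun s => by
      rw [← map_inv]; rfl
    rw [Equiv.Perm.mul_apply, Equiv.Perm.mul_apply, hinv, htS, unitsPerm_apply, ← mul_assoc,
      hab, mul_assoc, Units.mul_inv_cancel_left, mul_assoc]

theorem IsReesMonoid.exists_injective_hom_perm (hS : IsReesMonoid S) :
    ∃ F : S →* Equiv.Perm (S × List S), Function.Injective F := by
  obtain ⟨F, hF⟩ := hS.exists_hom_perm
  refine ⟨F, fun s s' h => ?_⟩
  have := hF s 1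
  rw [h, hF] at this
  simpa [eq_comm] using this

theorem IsReesMonoid.embedsInGroup (hS : IsReesMonoid S) : EmbedsInGroup S := by
  obtain ⟨F, hF⟩ := hS.exists_injective_hom_perm
  exact ⟨_, inferInstance, F, hF⟩

theorem EmbedsInGroup.isRightCancelMul (h : EmbedsInGroup S) : IsRightCancelMul S := by
  obtain ⟨H, _, f, hf⟩ := h
  exact ⟨fun a b c h => hf (by simpa using congrArg f h)⟩

end Embedding

/-! ### The universal group -/

namespace UniversalGroup

variable {S : Type u} [Monoid S]

/-- The homomorphism from the universal group induced by a homomorphism to a group. -/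
noncomputable def lift {H : Type v} [Group H] (φ : S →* H) : UniversalGroup S →* H :=
  (existsUnique_lift φ).choose

@[simp] theorem lift_ι {H : Type v} [Group H] (φ : S →* H) (s : S) : lift φ (ι S s) = φ s :=
  DFunLike.congr_fun (existsUnique_lift φ).choose_spec.1 s

theorem hom_ext {H : Type v} [Group H] {f g : UniversalGroup S →* H}
    (h : ∀ s, f (ι S s) = g (ι S s)) : f = g :=
  (existsUnique_lift (g.comp (ι S))).unique (MonoidHom.ext h) rfl

theorem ι_injective_of_injective {H : Type v} [Group H] {φ : S →* H}
    (hφ : Function.Injective φ) : Function.Injective (ι S) := fun s t h =>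
  hφ (by rw [← lift_ι φ, h, lift_ι])

end UniversalGroup

/-! ### The amalgamated product of the components -/

section Components

variable {S : Type u} [Monoid S] {X : Set S}

theorem mem_reesComponent_mk (x : X) :
    (x : S) ∈ reesComponent X (Quotient.mk (basisOrbitRel X) x) :=
  Submonoid.subset_closure (Or.inl ⟨x, rfl, rfl⟩)

/-- Elements of a Rees monoid are determined by their images in a group, hence so are units by
their images in the universal group of a component. -/
theorem IsReesMonoid.unitsToUniversalGroup_injective (hS : IsReesMonoid S) (X : Set S)
    (i : BasisOrbit X) : Function.Injective (unitsToUniversalGroup X i) := by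
  obtain ⟨F, hF⟩ := hS.exists_injective_hom_perm
  have hι := UniversalGroup.ι_injective_of_injective
    (φ := F.comp (reesComponent X i).subtype) (hF.comp Subtype.val_injective)
  exact fun g h e => Units.ext (congrArg Subtype.val (hι e))

/-- The image of an element of the component `Sᵢ` in the amalgamated product of the universal
groups of the components. -/
def componentToPushout (X : Set S) (i : BasisOrbit X) :
    reesComponent X i →* Monoid.PushoutI (unitsToUniversalGroup X) :=
  (Monoid.PushoutI.of i).comp (UniversalGroup.ι (reesComponent X i))

theorem componentToPushout_unit (i : BasisOrbit X) (g : Sˣ) :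
    componentToPushout X i (unitsToComponent X i g) =
      Monoid.PushoutI.base (unitsToUniversalGroup X) g :=
  Monoid.PushoutI.of_apply_eq_base (unitsToUniversalGroup X) i g

/-- The homomorphisms from the components to the amalgamated product are the restrictions of a
homomorphism on `S`: each of the defining relations `gx = yh` of `S` holds in one component. -/
theorem IsLeftBasis.exists_hom_pushout (hX : IsLeftBasis X) (hS : IsLeftReesMonoid S) :
    ∃ F : S →* Monoid.PushoutI (unitsToUniversalGroup X),
      (∀ i (s : reesComponent X i), F s = componentToPushout X i s) ∧
      ∀ g : Sˣ, F g = Monoid.PushoutI.base _ g := by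
  let f : X → Monoid.PushoutI (unitsToUniversalGroup X) := fun x =>
    componentToPushout X (Quotient.mk _ x) ⟨x, mem_reesComponent_mk x⟩
  have hf : ∀ (i) (x : X) (hx : (x : S) ∈ reesComponent X i), Quotient.mk _ x = i →
      f x = componentToPushout X i ⟨x, hx⟩ := by
    rintro _ x hx rfl
    rfl
  obtain ⟨F, hFX, hFG⟩ := hX.exists_hom hS f (Monoid.PushoutI.base _) (by
    intro g h x y e
    have hxy : Quotient.mk (basisOrbitRel X) x = Quotient.mk _ y := Quotient.sound ⟨g, h, e⟩
    rw [hf (Quotient.mk _ y) x (hxy ▸ mem_reesComponent_mk x) hxy,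
      hf (Quotient.mk _ y) y (mem_reesComponent_mk y) rfl,
      ← componentToPushout_unit (Quotient.mk _ y) g, ← componentToPushout_unit (Quotient.mk _ y) h,
      ← map_mul, ← map_mul]
    exact congrArg _ (Subtype.ext e))
  refine ⟨F, fun i s => ?_, hFG⟩
  have h : F.comp (reesComponent X i).subtype = componentToPushout X i := by
    refine MonoidHom.eq_of_eqOn_denseM Submonoid.closure_closure_coe_preimage ?_
    rintro ⟨s, hs⟩ (⟨x, rfl, hx⟩ | ⟨g, rfl⟩)
    · exact (hFX x).trans (hf i x hs hx)
    · exact (hFG g).trans (componentToPushout_unit i g).symm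
  exact DFunLike.congr_fun h s

/-- The universal group of a left Rees monoid is the free product of the universal groups of its
components with the group of units amalgamated. -/
theorem IsLeftBasis.exists_universalGroup_equiv (hX : IsLeftBasis X) (hS : IsLeftReesMonoid S) :
    ∃ e : UniversalGroup S ≃* Monoid.PushoutI (unitsToUniversalGroup X),
      ∀ (i : BasisOrbit X) (s : reesComponent X i),
        e (UniversalGroup.ι S s) =
          Monoid.PushoutI.of i (UniversalGroup.ι (reesComponent X i) s) := by
  obtain ⟨F, hF, hFG⟩ := hX.exists_hom_pushout hS
  let ψ : Monoid.PushoutI (unitsToUniversalGroup X) →* UniversalGroup S :=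
    Monoid.PushoutI.lift
      (fun i => UniversalGroup.lift ((UniversalGroup.ι S).comp (reesComponent X i).subtype))
      ((UniversalGroup.ι S).comp (Units.coeHom S))
      (fun i => MonoidHom.ext fun g => UniversalGroup.lift_ι _ _)
  have hψ : ∀ i (s : reesComponent X i), ψ (componentToPushout X i s) = UniversalGroup.ι S s :=
    fun i s => (Monoid.PushoutI.lift_of _ _ _ _).trans (UniversalGroup.lift_ι _ _)
  have hψG : ∀ g : Sˣ, ψ (Monoid.PushoutI.base _ g) = UniversalGroup.ι S g :=
    fun g => Monoid.PushoutI.lift_base _ _ _ _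
  have h₁ : ψ.comp F = UniversalGroup.ι S :=
    hX.hom_ext hS.toIsLeviMonoid
      (fun x => (congrArg ψ (hF _ ⟨x, mem_reesComponent_mk x⟩)).trans (hψ _ _))
      (fun g => (congrArg ψ (hFG g)).trans (hψG g))
  refine ⟨MonoidHom.toMulEquiv (UniversalGroup.lift F) ψ ?_ ?_, fun i s => ?_⟩
  · refine UniversalGroup.hom_ext fun s => ?_
    simpa using DFunLike.congr_fun h₁ s
  · refine Monoid.PushoutI.hom_ext (fun i => UniversalGroup.hom_ext fun s => ?_)
      (MonoidHom.ext fun g => ?_)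
    · change UniversalGroup.lift F (ψ (componentToPushout X i s)) = componentToPushout X i s
      rw [hψ, UniversalGroup.lift_ι, hF]
    · change UniversalGroup.lift F (ψ (Monoid.PushoutI.base _ g)) = Monoid.PushoutI.base _ g
      rw [hψG, UniversalGroup.lift_ι, hFG]
  · exact (UniversalGroup.lift_ι F _).trans (hF i s)

end Components

theorem mainTheorem5 (S : Type u) [Monoid S] :
    (IsLeftReesMonoid S → (EmbedsInGroup S ↔ IsRightCancelMul S)) ∧
    (IsReesMonoid S → ∀ X : Set S, IsLeftBasis X →
      (∀ i : BasisOrbit X, Function.Injective (unitsToUniversalGroup X i)) ∧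
      (∃ e : UniversalGroup S ≃* Monoid.PushoutI (unitsToUniversalGroup X),
        ∀ (i : BasisOrbit X) (s : reesComponent X i),
          e (UniversalGroup.ι S s) =
            Monoid.PushoutI.of i (UniversalGroup.ι (reesComponent X i) s)) ∧
      Function.Injective (UniversalGroup.ι S)) := by
  refine ⟨fun hS => ⟨EmbedsInGroup.isRightCancelMul, fun h => ?_⟩, fun hS X hX => ?_⟩
  · have := hS.toIsLeftCancelMul
    have hS' : IsReesMonoid S := ⟨hS.toIsLeviMonoid, {}⟩
    exact hS'.embedsInGroup
  · have := hS.toIsCancelMul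
    obtain ⟨F, hF⟩ := hS.exists_injective_hom_perm
    exact ⟨hS.unitsToUniversalGroup_injective X,
      hX.exists_universalGroup_equiv ⟨hS.toIsLeviMonoid, inferInstance⟩,
      UniversalGroup.ι_injective_of_injective hF⟩
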